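/- There is an absolute constant $C>0$ such that the following holds. Let $n\in\mathbb{N}$, let $K\subset\mathbb{R}^n$ be a convex body (compact, convex, with nonempty interior), and let $\varphi$ be a $\vartheta$-self-concordant barrier for $K$, that is, $\vartheta\ge 0$ and $\varphi:\operatorname{int}K\to\mathbb{R}$ is a convex $C^3$ function with $\varphi(x)\to+\infty$ as $x\to\partial K$ such that, for all $x\in\operatorname{int}K$ and $h\in\mathbb{R}^n$, $$|D^3\varphi(x)[h,h,h]|\le 2\,\bigl(D^2\varphi(x)[h,h]\bigr)^{3/2},\qquad \bigl(D\varphi(x)[h]\bigr)^2\le\vartheta\, D^2\varphi(x)[h,h].$$ Let $\sigma>0$ and $s>0$, and let $\mu_s$ be the probability measure on $\mathbb{R}^n$ whose density is proportional to $e^{-\frac{s}{\sigma^2}\varphi(x)}$ on $\operatorname{int}K$ and is $0$ elsewhere. Then $\mu_s$ is well defined, $\varphi$ is square-integrable with respect to $\mu_s$, and $$\operatorname{Var}_{x\sim\mu_s}\varphi(x)\le C\,\frac{\sigma^2}{s}\,\vartheta .$$ -/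

import Mathlib

open MeasureTheory ProbabilityTheory Set Filter Topology

noncomputable section

/-- The `k`-th directional derivative `D^k φ(x)[h, …, h]` of `φ` on `ℝⁿ`. -/
def dirDeriv {n : ℕ} (k : ℕ) (φ : EuclideanSpace ℝ (Fin n) → ℝ)
    (x h : EuclideanSpace ℝ (Fin n)) : ℝ :=
  iteratedFDeriv ℝ k φ x (fun _ => h)

/-- `φ` is a (standard) self-concordant function on the interior of `K`, in the sense of Nesterov
and Nemirovskii: it is `C³` and convex there, `|D³φ(x)[h,h,h]| ≤ 2 (D²φ(x)[h,h])^{3/2}`, and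
`φ` tends to `+∞` at the boundary of `K`. Only the values of `φ` on the interior of `K` matter. -/
structure IsSelfConcordant {n : ℕ} (K : Set (EuclideanSpace ℝ (Fin n)))
    (φ : EuclideanSpace ℝ (Fin n) → ℝ) : Prop where
  contDiffOn : ContDiffOn ℝ 3 φ (interior K)
  convexOn : ConvexOn ℝ (interior K) φ
  third_deriv_le : ∀ x ∈ interior K, ∀ h : EuclideanSpace ℝ (Fin n),
    |dirDeriv 3 φ x h| ≤ 2 * (dirDeriv 2 φ x h) ^ (3 / 2 : ℝ)
  tendsto_atTop : ∀ z ∈ frontier K, Tendsto φ (𝓝[interior K] z) atTop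

/-- `φ` is a `ϑ`-self-concordant barrier for `K`: a self-concordant function such that
`(Dφ(x)[h])² ≤ ϑ D²φ(x)[h,h]` for every interior point `x` and direction `h` (when the Hessian is
invertible this says `∇φ(x)ᵀ (∇²φ(x))⁻¹ ∇φ(x) ≤ ϑ`). -/
structure IsSelfConcordantBarrier {n : ℕ} (ϑ : ℝ) (K : Set (EuclideanSpace ℝ (Fin n)))
    (φ : EuclideanSpace ℝ (Fin n) → ℝ) : Prop extends IsSelfConcordant K φ where
  param_nonneg : 0 ≤ ϑ
  sq_deriv_le : ∀ x ∈ interior K, ∀ h : EuclideanSpace ℝ (Fin n),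
    (dirDeriv 1 φ x h) ^ 2 ≤ ϑ * dirDeriv 2 φ x h

open Classical in
/-- The Gibbs weight `f(τ, x) = exp (-τ⁻¹ φ(x))` for `x` in `K`, and `0` otherwise. Since
`φ = +∞` on the boundary of `K`, the weight is `0` there. -/
def gibbsWeight {n : ℕ} (K : Set (EuclideanSpace ℝ (Fin n)))
    (φ : EuclideanSpace ℝ (Fin n) → ℝ) (τ : ℝ) (x : EuclideanSpace ℝ (Fin n)) : ℝ :=
  if x ∈ interior K then Real.exp (-(τ⁻¹ * φ x)) else 0

/-- The Gibbs distribution at temperature `τ`: the measure on `ℝⁿ` whose Lebesgue density is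
`f(τ, ·)` divided by its total integral. -/
def gibbsMeasure {n : ℕ} (K : Set (EuclideanSpace ℝ (Fin n)))
    (φ : EuclideanSpace ℝ (Fin n) → ℝ) (τ : ℝ) : Measure (EuclideanSpace ℝ (Fin n)) :=
  (∫⁻ x, ENNReal.ofReal (gibbsWeight K φ τ x))⁻¹ •
    volume.withDensity (fun x => ENNReal.ofReal (gibbsWeight K φ τ x))

end

/-!
The constant `C = 1` works. Write `β = s / σ²` for the inverse temperature and
`Z(β) = ∫ exp (-β φ)` over the interior of `K`. The variance of `φ` under the Gibbs measure is
`(log Z)''(β)`, so the claim is the differential inequality `(log Z)'' ≤ ϑ / β`, that is, the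
log-concavity in `β` of `Z(β) exp (-ϑ β log β)`.

By the Prékopa–Leindler inequality (`prekopaLeindler`), this log-concavity follows once the function
`(β, x) ↦ β φ(x) + ϑ β log β` is known to be jointly convex. Its Hessian is
`!![ϑ / β, Dφ; Dφ, β D²φ]`, which is positive semidefinite exactly because of the barrier inequality
`(Dφ[h])² ≤ ϑ D²φ[h, h]` (`IsSelfConcordantBarrier.hessian_nonneg` and
`IsSelfConcordantBarrier.convexOn_mul_add_mul_log`).

The Prékopa–Leindler inequality is proved from the one-dimensional Brunn–Minkowski inequality
`volume_add_volume_le`, applied to superlevel sets, by induction on the dimension. Differentiation of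
`log Z` under the integral sign is the theory of cumulant generating functions of Mathlib: the Gibbs
measure is an exponential tilt of Lebesgue measure on the interior of `K`
(`gibbsMeasure_eq_tilted`), and all exponential moments that are needed exist because a convex
function on a bounded open set is bounded below (`IsSelfConcordant.exists_forall_le`).
-/

open scoped ENNReal

/-! ### The Prékopa–Leindler inequality -/

theorem volume_add_volume_le_of_isCompact {A B S : Set ℝ} (hA : IsCompact A) (hB : IsCompact B)
    (hA₀ : A.Nonempty) (hB₀ : B.Nonempty) (h : ∀ x ∈ A, ∀ y ∈ B, x + y ∈ S) :
    volume A + volume B ≤ volume S := by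
  -- Translates of `A` and `B` that meet in at most the point `p + q`.
  obtain ⟨p, hpA, hp⟩ := hA.exists_isGreatest hA₀
  obtain ⟨q, hqB, hq⟩ := hB.exists_isLeast hB₀
  set A' : Set ℝ := (fun x => x + -q) ⁻¹' A with hA'
  set B' : Set ℝ := (fun x => x + -p) ⁻¹' B with hB'
  have hvA : volume A' = volume A := measure_preimage_add_right _ _ _
  have hvB : volume B' = volume B := measure_preimage_add_right _ _ _
  have hdisj : AEDisjoint volume A' B' := by
    refine measure_mono_null (t := {p + q}) ?_ (by simp)
    rintro x ⟨hxA, hxB⟩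
    have h1 := hp hxA
    have h2 := hq hxB
    simp only [mem_singleton_iff]
    linarith
  have hmB : MeasurableSet B' := hB.measurableSet.preimage (measurable_add_const _)
  rw [← hvA, ← hvB, ← measure_union₀ hmB.nullMeasurableSet hdisj]
  refine measure_mono (union_subset ?_ ?_)
  · intro x hx
    simpa using h _ hx q hqB
  · intro x hx
    simpa using h p hpA _ hx

/-- The one-dimensional Brunn–Minkowski inequality. It is stated for a set `S` containing the
sumset `A + B`, which itself need not be measurable. -/
theorem volume_add_volume_le {A B S : Set ℝ} (hA : MeasurableSet A) (hB : MeasurableSet B)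
    (hA₀ : A.Nonempty) (hB₀ : B.Nonempty) (h : ∀ x ∈ A, ∀ y ∈ B, x + y ∈ S) :
    volume A + volume B ≤ volume S := by
  obtain ⟨x₀, hx₀⟩ := hA₀
  obtain ⟨y₀, hy₀⟩ := hB₀
  rw [hA.measure_eq_iSup_isCompact, hB.measure_eq_iSup_isCompact]
  simp_rw [iSup_and']
  refine ENNReal.biSup_add_biSup_le' ⟨∅, by simp⟩ ⟨∅, by simp⟩ ?_
  rintro P ⟨hPA, hP⟩ Q ⟨hQB, hQ⟩
  -- The compact sets may be empty, so one point of `A` and one of `B` is added to them.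
  calc volume P + volume Q ≤ volume (insert x₀ P) + volume (insert y₀ Q) := by
        gcongr <;> exact subset_insert _ _
    _ ≤ volume S := volume_add_volume_le_of_isCompact (hP.insert _) (hQ.insert _)
        (insert_nonempty _ _) (insert_nonempty _ _) fun x hx y hy =>
          h x (insert_subset hx₀ hPA hx) y (insert_subset hy₀ hQB hy)

theorem lintegral_eq_lintegral_meas_ofReal_lt {f : ℝ → ℝ≥0∞} (hf : Measurable f)
    (hf' : ∀ x, f x ≠ ∞) :
    ∫⁻ x, f x = ∫⁻ t in Ioi (0 : ℝ), volume {x | ENNReal.ofReal t < f x} := by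
  have h := lintegral_eq_lintegral_meas_lt (volume : Measure ℝ) (f := fun x => (f x).toReal)
    (Eventually.of_forall fun x => ENNReal.toReal_nonneg) hf.ennreal_toReal.aemeasurable
  simp only [ENNReal.ofReal_toReal (hf' _)] at h
  rw [h]
  refine setLIntegral_congr_fun measurableSet_Ioi fun t ht => ?_
  simp only [ENNReal.ofReal_lt_iff_lt_toReal (le_of_lt ht) (hf' _)]

/-- When `f` and `g` both have supremum `1`, the one-dimensional Prékopa–Leindler inequality holds
with the arithmetic mean of the integrals in place of the geometric one, by the Brunn–Minkowski
inequality for the superlevel sets. -/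
theorem add_lintegral_le_of_iSup_eq_one {a b : ℝ} (ha : 0 < a) (hb : 0 < b) (hab : a + b = 1)
    {f g h : ℝ → ℝ≥0∞} (hf : Measurable f) (hg : Measurable g) (hh : Measurable h)
    (hf1 : ⨆ x, f x = 1) (hg1 : ⨆ x, g x = 1)
    (hfgh : ∀ x y, f x ^ a * g y ^ b ≤ h (a * x + b * y)) :
    ENNReal.ofReal a * (∫⁻ x, f x) + ENNReal.ofReal b * (∫⁻ x, g x) ≤ ∫⁻ x, h x := by
  have hfle : ∀ x, f x ≤ 1 := fun x => hf1 ▸ le_iSup f x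
  have hgle : ∀ x, g x ≤ 1 := fun x => hg1 ▸ le_iSup g x
  have key : ∀ t ∈ Ioi (0 : ℝ), ENNReal.ofReal a * volume {x | ENNReal.ofReal t < f x} +
      ENNReal.ofReal b * volume {x | ENNReal.ofReal t < g x} ≤
      volume {x | ENNReal.ofReal t < min (h x) 1} := by
    intro t ht
    have ht : 0 < t := ht
    rcases le_or_gt 1 t with h1 | h1
    · have h1' : 1 ≤ ENNReal.ofReal t := by simpa using h1
      have e1 : {x | ENNReal.ofReal t < f x} = ∅ :=
        eq_empty_of_forall_notMem fun x hx => absurd (lt_of_lt_of_le hx (hfle x)) h1'.not_gt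
      have e2 : {x | ENNReal.ofReal t < g x} = ∅ :=
        eq_empty_of_forall_notMem fun x hx => absurd (lt_of_lt_of_le hx (hgle x)) h1'.not_gt
      simp [e1, e2]
    have h1' : ENNReal.ofReal t < 1 := by simpa using h1
    have scale : ∀ {c : ℝ}, 0 < c → ∀ s : Set ℝ,
        volume ((c⁻¹ * ·) ⁻¹' s) = ENNReal.ofReal c * volume s := fun {c} hc s => by
      rw [Real.volume_preimage_mul_left (inv_ne_zero hc.ne'), inv_inv, abs_of_pos hc]
    rw [← scale ha, ← scale hb]
    obtain ⟨x₀, hx₀⟩ := lt_iSup_iff.1 (hf1 ▸ h1')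
    obtain ⟨y₀, hy₀⟩ := lt_iSup_iff.1 (hg1 ▸ h1')
    refine volume_add_volume_le
      ((measurableSet_lt measurable_const hf).preimage (measurable_const_mul _))
      ((measurableSet_lt measurable_const hg).preimage (measurable_const_mul _))
      ⟨a * x₀, by simpa [ha.ne'] using hx₀⟩ ⟨b * y₀, by simpa [hb.ne'] using hy₀⟩ ?_
    intro x hx y hy
    have hx : ENNReal.ofReal t < f (a⁻¹ * x) := hx
    have hy : ENNReal.ofReal t < g (b⁻¹ * y) := hy
    refine lt_min (lt_of_lt_of_le ?_ (hfgh (a⁻¹ * x) (b⁻¹ * y)) |>.trans_eq ?_) h1'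
    · calc ENNReal.ofReal t = ENNReal.ofReal t ^ a * ENNReal.ofReal t ^ b := by
            rw [← ENNReal.rpow_add _ _ (by simpa using ht) ENNReal.ofReal_ne_top, hab,
              ENNReal.rpow_one]
        _ < _ := ENNReal.mul_lt_mul (ENNReal.rpow_lt_rpow hx ha) (ENNReal.rpow_lt_rpow hy hb)
    · rw [mul_inv_cancel_left₀ ha.ne', mul_inv_cancel_left₀ hb.ne']
  calc _ ≤ ∫⁻ t in Ioi (0 : ℝ), (ENNReal.ofReal a * volume {x | ENNReal.ofReal t < f x} +
          ENNReal.ofReal b * volume {x | ENNReal.ofReal t < g x}) := by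
        rw [lintegral_eq_lintegral_meas_ofReal_lt hf
            fun x => ne_top_of_le_ne_top ENNReal.one_ne_top (hfle x),
          lintegral_eq_lintegral_meas_ofReal_lt hg
            fun x => ne_top_of_le_ne_top ENNReal.one_ne_top (hgle x)]
        exact (add_le_add (lintegral_const_mul_le _ _) (lintegral_const_mul_le _ _)).trans
          (le_lintegral_add _ _)
    _ ≤ ∫⁻ t in Ioi (0 : ℝ), volume {x | ENNReal.ofReal t < min (h x) 1} :=
        setLIntegral_mono' measurableSet_Ioi key
    _ = ∫⁻ x, min (h x) 1 := (lintegral_eq_lintegral_meas_ofReal_lt (hh.min measurable_const)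
        fun x => ne_top_of_le_ne_top ENNReal.one_ne_top (min_le_right _ _)).symm
    _ ≤ ∫⁻ x, h x := lintegral_mono fun x => min_le_left _ _

theorem ENNReal.rpow_mul_rpow_le_add {a b : ℝ} (ha : 0 < a) (hb : 0 < b) (hab : a + b = 1)
    (u v : ℝ≥0∞) : u ^ a * v ^ b ≤ ENNReal.ofReal a * u + ENNReal.ofReal b * v := by
  have h := ENNReal.young_inequality (u ^ a) (v ^ b) (Real.HolderConjugate.inv_inv ha hb hab)
  rwa [ENNReal.rpow_rpow_inv ha.ne', ENNReal.rpow_rpow_inv hb.ne', ENNReal.ofReal_inv_of_pos ha,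
    ENNReal.ofReal_inv_of_pos hb, div_eq_mul_inv, div_eq_mul_inv, inv_inv, inv_inv, mul_comm u,
    mul_comm v] at h

/-- Dividing `f` and `g` by their finite suprema reduces the inequality to
`add_lintegral_le_of_iSup_eq_one` and the weighted inequality of arithmetic and geometric means. -/
theorem prekopaLeindler_real_of_bounded {a b : ℝ} (ha : 0 < a) (hb : 0 < b) (hab : a + b = 1)
    {f g h : ℝ → ℝ≥0∞} (hf : Measurable f) (hg : Measurable g) (hh : Measurable h)
    (hf1 : ⨆ x, f x ≠ ∞) (hg1 : ⨆ x, g x ≠ ∞)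
    (hfgh : ∀ x y, f x ^ a * g y ^ b ≤ h (a * x + b * y)) :
    (∫⁻ x, f x) ^ a * (∫⁻ x, g x) ^ b ≤ ∫⁻ x, h x := by
  set F := ⨆ x, f x with hF
  set G := ⨆ x, g x with hG
  rcases eq_or_ne F 0 with hF0 | hF0
  · have : ∀ x, f x = 0 := by simpa [hF] using hF0
    simp [this, ha]
  rcases eq_or_ne G 0 with hG0 | hG0
  · have : ∀ x, g x = 0 := by simpa [hG] using hG0
    simp [this, hb]
  set c : ℝ≥0∞ := F ^ a * G ^ b with hc
  have hFa : F ^ a ≠ 0 := by simp [hF0, hf1]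
  have hGb : G ^ b ≠ 0 := by simp [hG0, hg1]
  have hFa' : F ^ a ≠ ∞ := ENNReal.rpow_ne_top_of_nonneg ha.le hf1
  have hGb' : G ^ b ≠ ∞ := ENNReal.rpow_ne_top_of_nonneg hb.le hg1
  have hc0 : c ≠ 0 := mul_ne_zero hFa hGb
  have hct : c ≠ ∞ := ENNReal.mul_ne_top hFa' hGb'
  have hdiv : ∀ u v : ℝ≥0∞, (u / F) ^ a * (v / G) ^ b = (u ^ a * v ^ b) / c := by
    intro u v
    rw [ENNReal.div_rpow_of_nonneg _ _ ha.le, ENNReal.div_rpow_of_nonneg _ _ hb.le, hc,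
      div_eq_mul_inv, div_eq_mul_inv, div_eq_mul_inv,
      ENNReal.mul_inv (Or.inl hFa) (Or.inl hFa')]
    ring
  have h1 := add_lintegral_le_of_iSup_eq_one ha hb hab (hf.div_const F) (hg.div_const G)
    (hh.div_const c) (by rw [← ENNReal.iSup_div, ← hF, ENNReal.div_self hF0 hf1])
    (by rw [← ENNReal.iSup_div, ← hG, ENNReal.div_self hG0 hg1])
    (fun x y => by rw [hdiv]; gcongr; exact hfgh x y)
  have h2 := (ENNReal.rpow_mul_rpow_le_add ha hb hab _ _).trans h1
  simp only [div_eq_mul_inv] at h2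
  rw [lintegral_mul_const _ hf, lintegral_mul_const _ hg, lintegral_mul_const _ hh,
    ← div_eq_mul_inv, ← div_eq_mul_inv, ← div_eq_mul_inv, hdiv] at h2
  rwa [ENNReal.div_le_iff hc0 hct, ENNReal.div_mul_cancel hc0 hct] at h2

theorem iSup_lintegral_min_natCast {f : ℝ → ℝ≥0∞} (hf : Measurable f) :
    ⨆ N : ℕ, ∫⁻ x, min (f x) N = ∫⁻ x, f x := by
  rw [← lintegral_iSup (fun N => hf.min measurable_const)
    (fun i j hij x => min_le_min_left _ (by exact_mod_cast hij))]
  refine lintegral_congr fun x => ?_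
  change ⨆ N : ℕ, f x ⊓ (N : ℝ≥0∞) = f x
  rw [← inf_iSup_eq, ENNReal.iSup_natCast, inf_top_eq]

/-- The one-dimensional Prékopa–Leindler inequality, obtained from the bounded case by truncating
`f` and `g`. The two truncation levels vary independently, since multiplication on `ℝ≥0∞`
commutes with suprema in each factor but is not continuous at `(0, ∞)`. -/
theorem prekopaLeindler_real {a b : ℝ} (ha : 0 < a) (hb : 0 < b) (hab : a + b = 1)
    {f g h : ℝ → ℝ≥0∞} (hf : Measurable f) (hg : Measurable g) (hh : Measurable h)
    (hfgh : ∀ x y, f x ^ a * g y ^ b ≤ h (a * x + b * y)) :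
    (∫⁻ x, f x) ^ a * (∫⁻ x, g x) ^ b ≤ ∫⁻ x, h x := by
  have hrpow : ∀ {c : ℝ}, 0 < c → ∀ u : ℕ → ℝ≥0∞, (⨆ N, u N) ^ c = ⨆ N, u N ^ c :=
    fun hc u => (ENNReal.orderIsoRpow _ hc).map_iSup u
  rw [← iSup_lintegral_min_natCast hf, ← iSup_lintegral_min_natCast hg, hrpow ha, hrpow hb,
    ENNReal.iSup_mul]
  refine iSup_le fun N => ?_
  rw [ENNReal.mul_iSup]
  refine iSup_le fun M => ?_
  have bdd : ∀ (u : ℝ → ℝ≥0∞) (N : ℕ), ⨆ x, min (u x) N ≠ ∞ := fun u N =>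
    ne_top_of_le_ne_top (ENNReal.natCast_ne_top N) (iSup_le fun x => min_le_right _ _)
  refine prekopaLeindler_real_of_bounded ha hb hab (hf.min measurable_const)
    (hg.min measurable_const) hh (bdd f N) (bdd g M) fun x y => le_trans ?_ (hfgh x y)
  gcongr <;> exact min_le_left _ _

/-- The Prékopa–Leindler inequality on `ℝⁿ`, by induction on `n`: the marginals in the first
coordinate satisfy the hypothesis of the one-dimensional inequality. -/
theorem prekopaLeindler_pi {a b : ℝ} (ha : 0 < a) (hb : 0 < b) (hab : a + b = 1) :
    ∀ {n : ℕ} {f g h : (Fin n → ℝ) → ℝ≥0∞}, Measurable f → Measurable g → Measurable h →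
    (∀ x y, f x ^ a * g y ^ b ≤ h (a • x + b • y)) →
    (∫⁻ x, f x) ^ a * (∫⁻ x, g x) ^ b ≤ ∫⁻ x, h x
  | 0, f, g, h, _, _, _, hfgh => by
    have hvol : (volume : Measure (Fin 0 → ℝ)) univ = 1 := by simp [volume_pi]
    rw [lintegral_unique, lintegral_unique, lintegral_unique, hvol, mul_one, mul_one, mul_one]
    convert hfgh default default
  | n + 1, f, g, h, hf, hg, hh, hfgh => by
    set e := (MeasurableEquiv.piFinSuccAbove (fun _ : Fin (n + 1) => ℝ) 0).symm with he
    have split : ∀ {u : (Fin (n + 1) → ℝ) → ℝ≥0∞}, Measurable u →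
        ∫⁻ x, u x = ∫⁻ t, ∫⁻ y, u (e (t, y)) := by
      intro u hu
      have hmp := (volume_preserving_piFinSuccAbove (fun _ : Fin (n + 1) => ℝ) 0).symm
      rw [← hmp.lintegral_comp hu, Measure.volume_eq_prod,
        lintegral_prod (fun z => u (e z)) (hu.comp e.measurable).aemeasurable]
    have meas : ∀ {u : (Fin (n + 1) → ℝ) → ℝ≥0∞}, Measurable u →
        Measurable fun t => ∫⁻ y, u (e (t, y)) :=
      fun hu => (hu.comp e.measurable).lintegral_prod_right'
    have sect : ∀ {u : (Fin (n + 1) → ℝ) → ℝ≥0∞}, Measurable u → ∀ t,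
        Measurable fun y => u (e (t, y)) :=
      fun hu t => hu.comp (e.measurable.comp measurable_prodMk_left)
    have hlin : ∀ (s t : ℝ) (x y : Fin n → ℝ),
        a • e (s, x) + b • e (t, y) = e (a * s + b * t, a • x + b • y) := by
      intro s t x y
      ext i
      refine Fin.cases ?_ (fun j => ?_) i <;>
        simp [he, MeasurableEquiv.piFinSuccAbove, Fin.insertNthEquiv]
    rw [split hf, split hg, split hh]
    refine prekopaLeindler_real ha hb hab (meas hf) (meas hg) (meas hh) fun s t => ?_
    refine prekopaLeindler_pi ha hb hab (sect hf s) (sect hg t) (sect hh _) fun x y => ?_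
    rw [← hlin]
    exact hfgh _ _

theorem prekopaLeindler {n : ℕ} {a b : ℝ} (ha : 0 < a) (hb : 0 < b) (hab : a + b = 1)
    {f g h : EuclideanSpace ℝ (Fin n) → ℝ≥0∞} (hf : Measurable f) (hg : Measurable g)
    (hh : Measurable h) (hfgh : ∀ x y, f x ^ a * g y ^ b ≤ h (a • x + b • y)) :
    (∫⁻ x, f x) ^ a * (∫⁻ x, g x) ^ b ≤ ∫⁻ x, h x := by
  have hmp := PiLp.volume_preserving_toLp (Fin n)
  rw [← hmp.lintegral_comp hf, ← hmp.lintegral_comp hg, ← hmp.lintegral_comp hh]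
  refine prekopaLeindler_pi ha hb hab (hf.comp hmp.measurable) (hg.comp hmp.measurable)
    (hh.comp hmp.measurable) fun x y => ?_
  simpa using hfgh (WithLp.toLp 2 x) (WithLp.toLp 2 y)

/-! ### Joint convexity of the energy -/

section Convexity

variable {n : ℕ} {K : Set (EuclideanSpace ℝ (Fin n))} {φ : EuclideanSpace ℝ (Fin n) → ℝ} {ϑ : ℝ}

theorem hasDerivAt_add_smul (x h : EuclideanSpace ℝ (Fin n)) (t : ℝ) :
    HasDerivAt (fun t : ℝ => x + t • h) h t := by
  simpa using ((hasDerivAt_id t).smul_const h).const_add x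

theorem IsSelfConcordant.contDiffAt (hφ : IsSelfConcordant K φ) {x : EuclideanSpace ℝ (Fin n)}
    (hx : x ∈ interior K) : ContDiffAt ℝ 3 φ x :=
  hφ.contDiffOn.contDiffAt (isOpen_interior.mem_nhds hx)

theorem IsSelfConcordant.hasDerivAt_line (hφ : IsSelfConcordant K φ)
    {x h : EuclideanSpace ℝ (Fin n)} {t : ℝ} (hx : x + t • h ∈ interior K) :
    HasDerivAt (fun t : ℝ => φ (x + t • h)) (dirDeriv 1 φ (x + t • h) h) t := by
  have hd : HasFDerivAt φ (fderiv ℝ φ (x + t • h)) (x + t • h) :=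
    ((hφ.contDiffAt hx).differentiableAt (by norm_num)).hasFDerivAt
  simpa [dirDeriv, Function.comp_def] using hd.comp_hasDerivAt t (hasDerivAt_add_smul x h t)

theorem IsSelfConcordant.hasDerivAt_dirDeriv_line (hφ : IsSelfConcordant K φ)
    {x h : EuclideanSpace ℝ (Fin n)} {t : ℝ} (hx : x + t • h ∈ interior K) :
    HasDerivAt (fun t : ℝ => dirDeriv 1 φ (x + t • h) h) (dirDeriv 2 φ (x + t • h) h) t := by
  have hd : HasFDerivAt (fderiv ℝ φ) (fderiv ℝ (fderiv ℝ φ) (x + t • h)) (x + t • h) :=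
    (((hφ.contDiffAt hx).fderiv_right (m := 2) (by norm_num)).differentiableAt
      (by norm_num)).hasFDerivAt
  have h1 := hd.comp_hasDerivAt t (hasDerivAt_add_smul x h t)
  simpa [dirDeriv, iteratedFDeriv_two_apply, Function.comp_def] using
    h1.clm_apply (hasDerivAt_const t h)

theorem IsSelfConcordant.convexOn_line (hφ : IsSelfConcordant K φ)
    (x h : EuclideanSpace ℝ (Fin n)) :
    ConvexOn ℝ {t : ℝ | x + t • h ∈ interior K} fun t => φ (x + t • h) := by
  have := hφ.convexOn.comp_affineMap (AffineMap.lineMap x (x + h))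
  simpa [AffineMap.lineMap_apply, Function.comp_def, preimage, add_comm] using this

theorem IsSelfConcordant.dirDeriv_two_nonneg (hφ : IsSelfConcordant K φ)
    {x : EuclideanSpace ℝ (Fin n)} (hx : x ∈ interior K) (h : EuclideanSpace ℝ (Fin n)) :
    0 ≤ dirDeriv 2 φ x h := by
  set S : Set ℝ := {t : ℝ | x + t • h ∈ interior K} with hS
  have hSo : IsOpen S := isOpen_interior.preimage (by fun_prop)
  have h0 : (0 : ℝ) ∈ S := by simpa [hS] using hx
  have hmono : MonotoneOn (fun t : ℝ => dirDeriv 1 φ (x + t • h) h) S := by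
    refine ((hφ.convexOn_line x h).monotoneOn_deriv
      fun t ht => (hφ.hasDerivAt_line ht).differentiableAt).congr fun t ht => ?_
    exact (hφ.hasDerivAt_line ht).deriv
  have hd : HasDerivAt (fun t : ℝ => dirDeriv 1 φ (x + t • h) h) (dirDeriv 2 φ x h) 0 := by
    simpa using hφ.hasDerivAt_dirDeriv_line (x := x) (h := h) (t := 0) h0
  have := hmono.derivWithin_nonneg (x := 0)
  rwa [derivWithin_of_isOpen hSo h0, hd.deriv] at this

/-- A convex function on a bounded open set lies above one of its tangent planes, hence is
bounded below. -/
theorem IsSelfConcordant.exists_forall_le (hφ : IsSelfConcordant K φ) (hK : Bornology.IsBounded K) :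
    ∃ m : ℝ, ∀ x ∈ interior K, m ≤ φ x := by
  rcases (interior K).eq_empty_or_nonempty with hne | ⟨x₀, hx₀⟩
  · exact ⟨0, by simp [hne]⟩
  obtain ⟨R, hR⟩ := hK.subset_closedBall x₀
  refine ⟨φ x₀ - ‖fderiv ℝ φ x₀‖ * R, fun x hx => ?_⟩
  have h0 : x₀ + (0 : ℝ) • (x - x₀) ∈ interior K := by simpa using hx₀
  have h1 : x₀ + (1 : ℝ) • (x - x₀) ∈ interior K := by simpa using hx
  have hs := (hφ.convexOn_line x₀ (x - x₀)).le_slope_of_hasDerivAt h0 h1 one_pos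
    (hφ.hasDerivAt_line h0)
  simp only [slope_def_field, zero_smul, one_smul, add_zero, add_sub_cancel, sub_zero,
    div_one] at hs
  have hb : ‖x - x₀‖ ≤ R := by
    simpa [dist_eq_norm] using hR (interior_subset hx)
  have hd : |fderiv ℝ φ x₀ (x - x₀)| ≤ ‖fderiv ℝ φ x₀‖ * R :=
    ((fderiv ℝ φ x₀).le_opNorm _).trans (by gcongr)
  have he : dirDeriv 1 φ x₀ (x - x₀) = fderiv ℝ φ x₀ (x - x₀) := by simp [dirDeriv]
  rw [he] at hs
  linarith [neg_abs_le (fderiv ℝ φ x₀ (x - x₀))]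

/-- The barrier inequality says exactly that the quadratic form with matrix
`!![ϑ / β, Dφ; Dφ, β D²φ]`, the Hessian of `(β, x) ↦ β φ(x) + ϑ β log β`, is nonnegative. -/
theorem IsSelfConcordantBarrier.hessian_nonneg (hφ : IsSelfConcordantBarrier ϑ K φ)
    {x : EuclideanSpace ℝ (Fin n)} (hx : x ∈ interior K) (h : EuclideanSpace ℝ (Fin n))
    {β : ℝ} (hβ : 0 < β) (δ : ℝ) :
    0 ≤ 2 * δ * dirDeriv 1 φ x h + β * dirDeriv 2 φ x h + ϑ * (δ ^ 2 / β) := by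
  set d := dirDeriv 1 φ x h
  set q := dirDeriv 2 φ x h
  have hq : 0 ≤ q := hφ.toIsSelfConcordant.dirDeriv_two_nonneg hx h
  have hd : d ^ 2 ≤ ϑ * q := hφ.sq_deriv_le x hx h
  have hϑ := hφ.param_nonneg
  have hsum : 0 ≤ β * q + ϑ * (δ ^ 2 / β) := by positivity
  -- Since `d ^ 2 ≤ ϑ q`, the cross term is at most twice the geometric mean of the other two.
  have hsq : (2 * δ * d) ^ 2 ≤ (β * q + ϑ * (δ ^ 2 / β)) ^ 2 := by
    have e : 4 * (β * q) * (ϑ * (δ ^ 2 / β)) = 4 * δ ^ 2 * (ϑ * q) := by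
      field_simp
    nlinarith [sq_nonneg (β * q - ϑ * (δ ^ 2 / β)), mul_le_mul_of_nonneg_left hd (sq_nonneg δ)]
  linarith [(abs_le_of_sq_le_sq' hsq hsum).1]

theorem IsSelfConcordantBarrier.convexOn_mul_add_mul_log (hφ : IsSelfConcordantBarrier ϑ K φ) :
    ConvexOn ℝ (Ioi (0 : ℝ) ×ˢ interior K)
      fun p => p.1 * φ p.2 + ϑ * (p.1 * Real.log p.1) := by
  have hsc := hφ.toIsSelfConcordant
  refine ⟨(convex_Ioi 0).prod hsc.convexOn.1, ?_⟩
  rintro ⟨β₀, x₀⟩ ⟨hβ₀, hx₀⟩ ⟨β₁, x₁⟩ ⟨hβ₁, hx₁⟩ a b ha hb hab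
  have hβ₀ : 0 < β₀ := hβ₀
  have hβ₁ : 0 < β₁ := hβ₁
  -- The function is restricted to the segment from `(β₀, x₀)` to `(β₁, x₁)`.
  set δ := β₁ - β₀ with hδ
  set h := x₁ - x₀ with hh
  have hB : ∀ t ∈ Icc (0 : ℝ) 1, 0 < β₀ + t * δ := by
    intro t ht
    have := (convex_Ioi (0 : ℝ)).add_smul_sub_mem hβ₀ hβ₁ ht
    simpa using this
  have hX : ∀ t ∈ Icc (0 : ℝ) 1, x₀ + t • h ∈ interior K := fun t ht =>
    hsc.convexOn.1.add_smul_sub_mem hx₀ hx₁ ht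
  have hlin : ∀ t, HasDerivAt (fun t : ℝ => β₀ + t * δ) δ t := fun t => by
    simpa using ((hasDerivAt_id t).mul_const δ).const_add β₀
  have hg : ∀ t ∈ Icc (0 : ℝ) 1, HasDerivAt
      (fun t => (β₀ + t * δ) * φ (x₀ + t • h) + ϑ * ((β₀ + t * δ) * Real.log (β₀ + t * δ)))
      (δ * φ (x₀ + t • h) + (β₀ + t * δ) * dirDeriv 1 φ (x₀ + t • h) h +
        ϑ * (δ * Real.log (β₀ + t * δ) + δ)) t := by
    intro t ht
    have hne := (hB t ht).ne'
    refine (((hlin t).mul (hsc.hasDerivAt_line (hX t ht))).add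
      (((hlin t).mul ((hlin t).log hne)).const_mul ϑ)).congr_deriv ?_
    rw [mul_div_cancel₀ _ hne]
  have hg' : ∀ t ∈ Icc (0 : ℝ) 1, HasDerivAt
      (fun t => δ * φ (x₀ + t • h) + (β₀ + t * δ) * dirDeriv 1 φ (x₀ + t • h) h +
        ϑ * (δ * Real.log (β₀ + t * δ) + δ))
      (2 * δ * dirDeriv 1 φ (x₀ + t • h) h + (β₀ + t * δ) * dirDeriv 2 φ (x₀ + t • h) h +
        ϑ * (δ ^ 2 / (β₀ + t * δ))) t := by
    intro t ht
    have hne := (hB t ht).ne'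
    refine ((((hsc.hasDerivAt_line (hX t ht)).const_mul δ).add
      ((hlin t).mul (hsc.hasDerivAt_dirDeriv_line (hX t ht)))).add
      (((((hlin t).log hne).const_mul δ).add_const δ).const_mul ϑ)).congr_deriv ?_
    ring
  have hsub : interior (Icc (0 : ℝ) 1) ⊆ Icc 0 1 := interior_subset
  have hconv := convexOn_of_hasDerivWithinAt2_nonneg (convex_Icc (0 : ℝ) 1)
    (fun t ht => (hg t ht).continuousAt.continuousWithinAt)
    (fun t ht => (hg t (hsub ht)).hasDerivWithinAt)
    (fun t ht => (hg' t (hsub ht)).hasDerivWithinAt)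
    (fun t ht => hφ.hessian_nonneg (hX t (hsub ht)) h (hB t (hsub ht)) δ)
  have key := hconv.2 (left_mem_Icc.2 zero_le_one) (right_mem_Icc.2 zero_le_one) ha hb hab
  obtain rfl : a = 1 - b := by linarith
  have e1 : (1 - b) * β₀ + b * β₁ = β₀ + b * δ := by
    rw [hδ]; ring
  have e2 : (1 - b) • x₀ + b • x₁ = x₀ + b • h := by
    rw [hh]; module
  simpa [e1, e2, hδ, hh] using key

end Convexity

/-! ### The partition function and the variance -/

section Gibbs

variable {n : ℕ} {K : Set (EuclideanSpace ℝ (Fin n))} {φ : EuclideanSpace ℝ (Fin n) → ℝ} {ϑ : ℝ}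

theorem restrict_interior_ne_zero (hne : (interior K).Nonempty) :
    (volume : Measure (EuclideanSpace ℝ (Fin n))).restrict (interior K) ≠ 0 := by
  rw [Ne, Measure.restrict_eq_zero]
  exact (isOpen_interior.measure_pos _ hne).ne'

theorem IsSelfConcordant.integrable_exp (hφ : IsSelfConcordant K φ) (hK : Bornology.IsBounded K)
    {β : ℝ} (hβ : 0 < β) :
    Integrable (fun x => Real.exp (β * (-φ) x)) (volume.restrict (interior K)) := by
  obtain ⟨m, hm⟩ := hφ.exists_forall_le hK
  have : IsFiniteMeasure ((volume : Measure (EuclideanSpace ℝ (Fin n))).restrict (interior K)) :=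
    ⟨by simpa using (hK.subset interior_subset).measure_lt_top⟩
  have hcont : ContinuousOn (fun x => Real.exp (β * (-φ) x)) (interior K) :=
    (continuousOn_const.mul hφ.contDiffOn.continuousOn.neg).rexp
  refine Integrable.of_bound (hcont.aestronglyMeasurable isOpen_interior.measurableSet)
    (Real.exp (β * -m)) ?_
  filter_upwards [ae_restrict_mem isOpen_interior.measurableSet] with x hx
  rw [Real.norm_of_nonneg (Real.exp_pos _).le]
  have := hm x hx
  gcongr
  simpa using this

theorem IsSelfConcordant.mem_interior_integrableExpSet (hφ : IsSelfConcordant K φ)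
    (hK : Bornology.IsBounded K) {β : ℝ} (hβ : 0 < β) :
    β ∈ interior (integrableExpSet (-φ) (volume.restrict (interior K))) :=
  mem_interior.2 ⟨Ioi 0, fun _ ht => hφ.integrable_exp hK ht, isOpen_Ioi, hβ⟩

/-- The Gibbs measure at inverse temperature `τ⁻¹` is an exponential tilt of Lebesgue measure on the
interior of `K`, so that the log-partition function is the cumulant generating function of `-φ`. -/
theorem gibbsMeasure_eq_tilted {τ : ℝ} (hne : (interior K).Nonempty)
    (hint : Integrable (fun x => Real.exp (τ⁻¹ * (-φ) x)) (volume.restrict (interior K))) :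
    gibbsMeasure K φ τ = (volume.restrict (interior K)).tilted fun x => τ⁻¹ * (-φ) x := by
  have : NeZero ((volume : Measure (EuclideanSpace ℝ (Fin n))).restrict (interior K)) :=
    ⟨restrict_interior_ne_zero hne⟩
  have hpos : 0 < ∫ x in interior K, Real.exp (τ⁻¹ * (-φ) x) := integral_exp_pos hint
  have hw : (fun x => ENNReal.ofReal (gibbsWeight K φ τ x)) =
      (interior K).indicator fun x => ENNReal.ofReal (Real.exp (τ⁻¹ * (-φ) x)) := by
    ext x
    by_cases hx : x ∈ interior K <;> simp [gibbsWeight, hx]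
  have hmeas : MeasurableSet (interior K) := isOpen_interior.measurableSet
  rw [gibbsMeasure, hw, lintegral_indicator hmeas, withDensity_indicator hmeas,
    ← ofReal_integral_eq_lintegral_ofReal hint (Eventually.of_forall fun x => (Real.exp_pos _).le),
    ← withDensity_smul' _ _ (by simpa using hpos), Measure.tilted]
  congr 1
  ext x
  rw [ENNReal.ofReal_div_of_pos hpos, ENNReal.div_eq_inv_mul, Pi.smul_apply, smul_eq_mul]

/-- The Prékopa–Leindler inequality applied to `exp (-(β φ + ϑ β log β))`: the function
`β ↦ Z(β) exp (-ϑ β log β)` is log-concave, where `Z` is the partition function. -/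
theorem IsSelfConcordantBarrier.concaveOn_cgf_sub (hφ : IsSelfConcordantBarrier ϑ K φ)
    (hK : Bornology.IsBounded K) (hne : (interior K).Nonempty) :
    ConcaveOn ℝ (Ioi 0) fun β =>
      cgf (-φ) (volume.restrict (interior K)) β - ϑ * (β * Real.log β) := by
  set μ := (volume : Measure (EuclideanSpace ℝ (Fin n))).restrict (interior K) with hμ
  have hsc := hφ.toIsSelfConcordant
  have hmeas : MeasurableSet (interior K) := isOpen_interior.measurableSet
  set G : ℝ → ℝ := fun β => cgf (-φ) μ β - ϑ * (β * Real.log β) with hG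
  set w : ℝ → EuclideanSpace ℝ (Fin n) → ℝ≥0∞ := fun β => (interior K).indicator fun x =>
    ENNReal.ofReal (Real.exp (-(β * φ x + ϑ * (β * Real.log β)))) with hw
  have hwm : ∀ β, Measurable (w β) := by
    intro β
    have hc : ContinuousOn
        (fun x => ENNReal.ofReal (Real.exp (-(β * φ x + ϑ * (β * Real.log β))))) (interior K) :=
      ENNReal.continuous_ofReal.comp_continuousOn
        ((continuousOn_const.mul hsc.contDiffOn.continuousOn).add continuousOn_const).neg.rexp
    classical
    simp only [hw, ← piecewise_eq_indicator]
    exact hc.measurable_piecewise continuousOn_const hmeas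
  have hwi : ∀ β, 0 < β → ∫⁻ x, w β x = ENNReal.ofReal (Real.exp (G β)) := by
    intro β hβ
    have hint := hsc.integrable_exp hK hβ
    have he : ∀ x, Real.exp (-(β * φ x + ϑ * (β * Real.log β))) =
        Real.exp (β * (-φ) x) * Real.exp (-(ϑ * (β * Real.log β))) := fun x => by
      rw [← Real.exp_add]
      congr 1
      simp only [Pi.neg_apply]
      ring
    rw [hw, lintegral_indicator hmeas]
    simp only [he]
    rw [← ofReal_integral_eq_lintegral_ofReal (hint.mul_const _)
      (Eventually.of_forall fun x => by positivity), integral_mul_const]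
    simp only [hG]
    rw [sub_eq_add_neg, Real.exp_add, cgf, Real.exp_log (mgf_pos' (restrict_interior_ne_zero hne) hint), mgf]
  refine ⟨convex_Ioi 0, fun β₀ hβ₀ β₁ hβ₁ a b ha hb hab => ?_⟩
  rcases ha.eq_or_lt with rfl | ha
  · obtain rfl : b = 1 := by linarith
    simp
  rcases hb.eq_or_lt with rfl | hb
  · obtain rfl : a = 1 := by linarith
    simp
  have hB : 0 < a • β₀ + b • β₁ := (convex_Ioi (0 : ℝ)) hβ₀ hβ₁ ha.le hb.le hab
  have hpl := prekopaLeindler ha hb hab (hwm β₀) (hwm β₁) (hwm (a • β₀ + b • β₁)) fun x y => by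
    by_cases hx : x ∈ interior K
    swap; · simp [hw, hx, ha]
    by_cases hy : y ∈ interior K
    swap; · simp [hw, hy, hb]
    have hxy : a • x + b • y ∈ interior K := hsc.convexOn.1 hx hy ha.le hb.le hab
    have hconv := hφ.convexOn_mul_add_mul_log.2 (x := (β₀, x)) ⟨hβ₀, hx⟩ (y := (β₁, y)) ⟨hβ₁, hy⟩
      ha.le hb.le hab
    simp only [hw, indicator_of_mem hx, indicator_of_mem hy, indicator_of_mem hxy]
    rw [ENNReal.ofReal_rpow_of_pos (Real.exp_pos _), ENNReal.ofReal_rpow_of_pos (Real.exp_pos _),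
      ← ENNReal.ofReal_mul (by positivity), ← Real.exp_mul, ← Real.exp_mul, ← Real.exp_add]
    refine ENNReal.ofReal_le_ofReal (Real.exp_le_exp.2 ?_)
    simp only [Prod.smul_mk, Prod.mk_add_mk, smul_eq_mul] at hconv ⊢
    linarith
  rw [hwi _ hβ₀, hwi _ hβ₁, hwi _ hB, ENNReal.ofReal_rpow_of_pos (Real.exp_pos _),
    ENNReal.ofReal_rpow_of_pos (Real.exp_pos _), ← ENNReal.ofReal_mul (by positivity),
    ← Real.exp_mul, ← Real.exp_mul, ← Real.exp_add,
    ENNReal.ofReal_le_ofReal_iff (Real.exp_pos _).le, Real.exp_le_exp] at hpl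
  simp only [smul_eq_mul, hG] at hpl ⊢
  linarith

theorem IsSelfConcordantBarrier.iteratedDeriv_two_cgf_le (hφ : IsSelfConcordantBarrier ϑ K φ)
    (hK : Bornology.IsBounded K) (hne : (interior K).Nonempty) {β : ℝ} (hβ : 0 < β) :
    iteratedDeriv 2 (cgf (-φ) (volume.restrict (interior K))) β ≤ ϑ / β := by
  set c := cgf (-φ) (volume.restrict (interior K)) with hc
  have han : ∀ t ∈ Ioi (0 : ℝ), AnalyticAt ℝ c t := fun t ht =>
    analyticAt_cgf (hφ.toIsSelfConcordant.mem_interior_integrableExpSet hK ht)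
  have hd : ∀ t ∈ Ioi (0 : ℝ), HasDerivAt (fun t => c t - ϑ * (t * Real.log t))
      (deriv c t - ϑ * (Real.log t + 1)) t := fun t ht =>
    (han t ht).differentiableAt.hasDerivAt.sub
      ((Real.hasDerivAt_mul_log (ne_of_gt ht)).const_mul ϑ)
  have hanti : AntitoneOn (fun t => deriv c t - ϑ * (Real.log t + 1)) (Ioi 0) :=
    ((hφ.concaveOn_cgf_sub hK hne).antitoneOn_deriv fun t ht => (hd t ht).differentiableAt).congr
      fun t ht => (hd t ht).deriv
  have hd2 : HasDerivAt (fun t => deriv c t - ϑ * (Real.log t + 1))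
      (deriv (deriv c) β - ϑ * β⁻¹) β :=
    (han β hβ).deriv.differentiableAt.hasDerivAt.sub
      (((Real.hasDerivAt_log hβ.ne').add_const 1).const_mul ϑ)
  have h := hanti.derivWithin_nonpos (x := β)
  rw [derivWithin_of_isOpen isOpen_Ioi hβ, hd2.deriv] at h
  rw [iteratedDeriv_succ, iteratedDeriv_one, div_eq_mul_inv]
  linarith

end Gibbs

theorem mainTheorem8 :
    ∃ C : ℝ, 0 < C ∧
      ∀ (n : ℕ) (K : ConvexBody (EuclideanSpace ℝ (Fin n))),
        (interior (K : Set (EuclideanSpace ℝ (Fin n)))).Nonempty →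
      ∀ (φ : EuclideanSpace ℝ (Fin n) → ℝ) (ϑ : ℝ),
        IsSelfConcordantBarrier ϑ (K : Set (EuclideanSpace ℝ (Fin n))) φ →
      ∀ σ s : ℝ, 0 < σ → 0 < s →
        IsProbabilityMeasure (gibbsMeasure (K : Set (EuclideanSpace ℝ (Fin n))) φ (σ ^ 2 / s)) ∧
        MemLp φ 2 (gibbsMeasure (K : Set (EuclideanSpace ℝ (Fin n))) φ (σ ^ 2 / s)) ∧
        variance φ (gibbsMeasure (K : Set (EuclideanSpace ℝ (Fin n))) φ (σ ^ 2 / s)) ≤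
          C * (σ ^ 2 / s * ϑ) := by
  refine ⟨1, one_pos, fun n K hne φ ϑ hφ σ s hσ hs => ?_⟩
  have hK : Bornology.IsBounded (K : Set (EuclideanSpace ℝ (Fin n))) := K.isCompact.isBounded
  have hβ : 0 < (σ ^ 2 / s)⁻¹ := by positivity
  have hint := hφ.toIsSelfConcordant.integrable_exp hK hβ
  have hmem := hφ.toIsSelfConcordant.mem_interior_integrableExpSet hK hβ
  have : NeZero ((volume : Measure (EuclideanSpace ℝ (Fin n))).restrict
      (interior (K : Set (EuclideanSpace ℝ (Fin n))))) := ⟨restrict_interior_ne_zero hne⟩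
  rw [gibbsMeasure_eq_tilted hne hint]
  refine ⟨isProbabilityMeasure_tilted hint, ?_, ?_⟩
  · simpa using (memLp_tilted_mul hmem 2).neg
  · have hle := hφ.iteratedDeriv_two_cgf_le hK hne hβ
    rw [← variance_tilted_mul hmem, variance_neg] at hle
    rwa [div_inv_eq_mul, mul_comm, ← one_mul (σ ^ 2 / s * ϑ)] at hle
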